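/- A metric space $(X,d)$ is called monotone if there are a linear order $<$ on $X$ and a constant $c>0$ such that $d(x,y)\le c\,d(x,z)$ for all $x<y<z$ in $X$; it is $\sigma$-monotone if it is a countable union of monotone subspaces. A set $X\subseteq\mathbb R^2$ (Euclidean plane) is called strongly porous if there is $p>0$ such that for every $x\in\mathbb R^2$ and every $r\in(0,\operatorname{diam}X)$ there is $y\in\mathbb R^2$ with $B(y,pr)\subseteq B(x,r)\setminus X$, where $B$ denotes closed balls. Let $\|x\|=\operatorname{dist}(x,\mathbb R\setminus[-1,1])=\max(0,1-|x|)$ for $x\in\mathbb R$. Theorem. Let $(q_n)_{n\in\mathbb N}$ be any enumeration, without repetition, of the rationals in $[0,1]$. Then there are sequences $(a_n)$, $(b_n)$ of positive reals with $\sum_n a_n<\infty$ such that the function $f:[0,1]\to\mathbb R$, $$f(x)=\sum_{n\in\mathbb N}a_n\Bigl\|\frac{x-q_n}{b_n}\Bigr\|,$$ is absolutely continuous, its graph $\Gamma=\{(x,f(x)):x\in[0,1]\}\subseteq\mathbb R^2$ is strongly porous, and every monotone subset of $\Gamma$ is nowhere dense in $\Gamma$. In particular, $\Gamma$ is not $\sigma$-monotone.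 -/

import Mathlib

/-- A metric space is monotone if some linear order `<` on it and some constant `c > 0` satisfy
`d(x, y) ≤ c d(x, z)` whenever `x < y < z`. -/
def IsMonotoneSpace (X : Type*) [MetricSpace X] : Prop :=
  ∃ (_ : LinearOrder X) (c : ℝ), 0 < c ∧
    ∀ x y z : X, x < y → y < z → dist x y ≤ c * dist x z

/-- A metric space is σ-monotone if it is a countable union of monotone subspaces. -/
def IsSigmaMonotoneSpace (X : Type*) [MetricSpace X] : Prop :=
  ∃ M : ℕ → Set X, (∀ n, IsMonotoneSpace (M n)) ∧ ⋃ n, M n = Set.univ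

/-- A set `X` in the Euclidean plane is strongly porous if there is `p > 0` such that for every
point `x` and every `r ∈ (0, diam X)` some closed ball of radius `p r` is contained in
`B(x, r) ∖ X`. The diameter is taken in `[0, ∞]`. -/
def IsStronglyPorous (X : Set (EuclideanSpace ℝ (Fin 2))) : Prop :=
  ∃ p : ℝ, 0 < p ∧ ∀ (x : EuclideanSpace ℝ (Fin 2)) (r : ℝ),
    0 < r → ENNReal.ofReal r < Metric.ediam X →
      ∃ y : EuclideanSpace ℝ (Fin 2),
        Metric.closedBall y (p * r) ⊆ Metric.closedBall x r \ X

/-- The graph over `[0, 1]` of a real function, as a set in the Euclidean plane. -/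
def unitGraph (f : ℝ → ℝ) : Set (EuclideanSpace ℝ (Fin 2)) :=
  (fun x : ℝ => !₂[x, f x]) '' Set.Icc (0 : ℝ) 1

/-- The tent function `x ↦ dist(x, ℝ ∖ [-1, 1])`, that is, `max (0, 1 - |x|)`. -/
noncomputable def tent (x : ℝ) : ℝ :=
  Metric.infDist x (Set.Icc (-1 : ℝ) 1)ᶜ

/-- The sequence `q` enumerates the rationals of `[0, 1]`, each exactly once. -/
def EnumeratesUnitRationals (q : ℕ → ℝ) : Prop :=
  Function.Injective q ∧ Set.range q = Set.Icc (0 : ℝ) 1 ∩ Set.range ((↑) : ℚ → ℝ)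

theorem exists_enumeratesUnitRationals : ∃ q : ℕ → ℝ, EnumeratesUnitRationals q := by
  have hc : (Set.Icc (0 : ℝ) 1 ∩ Set.range ((↑) : ℚ → ℝ)).Countable :=
    (Set.countable_range _).mono Set.inter_subset_right
  have hi : (Set.Icc (0 : ℝ) 1 ∩ Set.range ((↑) : ℚ → ℝ)).Infinite := by
    refine Set.infinite_of_injective_forall_mem (f := fun n : ℕ => (1 / ((n : ℝ) + 1)))
      (fun m n h => ?_) (fun n => ⟨⟨by positivity, ?_⟩, ⟨1 / ((n : ℚ) + 1), by push_cast; rfl⟩⟩)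
    · have h1 : (m : ℝ) + 1 = n + 1 := by simpa using h
      exact_mod_cast add_right_cancel h1
    · rw [div_le_one (by positivity)]
      linarith [Nat.cast_nonneg (α := ℝ) n]
  have := hc.to_subtype
  have := hi.to_subtype
  obtain ⟨e⟩ := nonempty_equiv_of_countable
    (α := ℕ) (β := ↥(Set.Icc (0 : ℝ) 1 ∩ Set.range ((↑) : ℚ → ℝ)))
  refine ⟨fun n => (e n : ℝ), Subtype.val_injective.comp e.injective, ?_⟩
  change Set.range (Subtype.val ∘ e) = _
  rw [e.surjective.range_comp, Subtype.range_coe]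

open Set Filter Topology MeasureTheory

/-! ### The tent function -/

/-! Spikes are chosen recursively (`RapidSpikes`), each very low compared with the earlier geometry
and very steep compared with the earlier slopes.

Absolute continuity: the `n`-th spike has total variation at most `2 * a n`, which is summable, so
the property passes from the terms to the sum.

Porosity: at scale `r`, the spikes lower than about `r` are negligible, and the earlier ones have
breakpoints so sparse that on an interval of length comparable to `r` their sum is affine. A nearly
affine graph misses a ball of comparable size (`exists_closedBall_disjoint_unitGraph`).

Monotone subsets: by connectedness, a monotone order on a dense part of an arc is the arc's own
order or its reverse (`lt_lt_or_lt_lt_of_monotone`). The foot, tip and other foot of a spike then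
violate the inequality for `c`, since the feet are close to each other and the tip is far from both
(`RapidSpikes.exists_steep_spike`). Such spikes lie over every interval because the rationals are
dense. Baire category excludes σ-monotonicity. -/

theorem tent_eq (x : ℝ) : tent x = max 0 (1 - |x|) := by
  unfold tent
  by_cases hx : x ∈ Icc (-1 : ℝ) 1
  · have habs : |x| ≤ 1 := abs_le.2 hx
    rw [max_eq_right (by linarith)]
    have hne : ((Icc (-1 : ℝ) 1)ᶜ).Nonempty := ⟨2, by simp⟩
    apply le_antisymm
    -- The distance is not attained, since `±1` lie outside the open complement; points at distance
    -- `ε` beyond them are used.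
    · refine le_of_forall_pos_le_add fun ε hε => ?_
      rcases le_total 0 x with h | h
      · refine (Metric.infDist_le_dist_of_mem (y := 1 + ε) ?_).trans ?_
        · simp only [mem_compl_iff, mem_Icc, not_and, not_le]; intro _; linarith
        · rw [Real.dist_eq, abs_of_nonneg h, abs_sub_comm, abs_of_nonneg] <;> linarith [hx.2]
      · refine (Metric.infDist_le_dist_of_mem (y := -1 - ε) ?_).trans ?_
        · simp only [mem_compl_iff, mem_Icc, not_and, not_le]; intro _; linarith
        · rw [Real.dist_eq, abs_of_nonpos h, abs_of_nonneg] <;> linarith [hx.1]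
    · rw [Metric.le_infDist hne]
      intro y hy
      have hy' : 1 < |y| := by
        by_contra hcon
        exact hy (abs_le.1 (not_lt.1 hcon))
      have := abs_sub_abs_le_abs_sub y x
      rw [Real.dist_eq, abs_sub_comm]
      linarith
  · rw [Metric.infDist_zero_of_mem (mem_compl hx), max_eq_left]
    have : ¬ |x| ≤ 1 := fun h => hx (abs_le.1 h)
    linarith

theorem mul_tent_eq {b : ℝ} (hb : 0 < b) (a q x : ℝ) :
    a * tent ((x - q) / b) = a / b * max 0 (b - |x - q|) := by
  have h : max 0 (b - |x - q|) = b * max 0 (1 - |(x - q) / b|) := by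
    rw [mul_max_of_nonneg _ _ hb.le, abs_div, abs_of_pos hb, mul_zero, mul_sub, mul_one,
      mul_div_cancel₀ _ hb.ne']
  rw [tent_eq, h]
  field_simp

theorem tent_nonneg (x : ℝ) : 0 ≤ tent x := Metric.infDist_nonneg

theorem tent_le_one (x : ℝ) : tent x ≤ 1 := by
  rw [tent_eq]
  exact max_le zero_le_one (by linarith [abs_nonneg x])

theorem continuous_tent : Continuous tent := Metric.continuous_infDist_pt _

theorem abs_mul_tent_sub_le {a b : ℝ} (ha : 0 < a) (hb : 0 < b) (q x y : ℝ) :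
    |a * tent ((x - q) / b) - a * tent ((y - q) / b)| ≤ a / b * |x - y| := by
  rw [mul_tent_eq hb, mul_tent_eq hb, ← mul_sub, abs_mul, abs_of_pos (div_pos ha hb)]
  refine mul_le_mul_of_nonneg_left ?_ (div_pos ha hb).le
  refine (abs_max_sub_max_le_max (0 : ℝ) (b - |x - q|) 0 (b - |y - q|)).trans ?_
  rw [sub_self, abs_zero, max_eq_right (abs_nonneg _)]
  have := abs_abs_sub_abs_le_abs_sub (x - q) (y - q)
  rw [abs_sub_comm] at this
  calc |b - |x - q| - (b - |y - q|)| = |(|y - q|) - (|x - q|)| := by congr 1; ring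
    _ ≤ |x - q - (y - q)| := this
    _ = |x - y| := by congr 1; ring

/-- The increment of a spike is controlled by the part of the interval inside its support. -/
theorem abs_mul_tent_sub_le_volume {a b : ℝ} (ha : 0 < a) (hb : 0 < b) (q x y : ℝ) :
    |a * tent ((x - q) / b) - a * tent ((y - q) / b)| ≤
      a / b * volume.real (uIoc x y ∩ Ioc (q - b) (q + b)) := by
  wlog hxy : x ≤ y generalizing x y
  · rw [abs_sub_comm, uIoc_comm]
    exact this y x (le_of_not_ge hxy)
  rw [mul_tent_eq hb, mul_tent_eq hb, ← mul_sub, abs_mul, abs_of_pos (div_pos ha hb)]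
  gcongr
  rw [uIoc_of_le hxy, Ioc_inter_Ioc, Real.volume_real_Ioc]
  rcases le_total x (q - b) with h1 | h1 <;> rcases le_total y (q + b) with h2 | h2 <;>
  rcases abs_cases (x - q) with h3 | h3 <;> rcases abs_cases (y - q) with h4 | h4 <;>
  rw [abs_le] <;> grind

/-- Disjoint intervals meet the support, of length `2 * b`, in total measure at most `2 * b`, and
the slope there is `a / b`. The bound does not depend on the family of intervals, so it can serve as
a dominating sequence. -/
theorem sum_abs_mul_tent_sub_le {a b : ℝ} (ha : 0 < a) (hb : 0 < b) (q : ℝ)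
    (n : ℕ) (I : ℕ → ℝ × ℝ)
    (hI : Set.PairwiseDisjoint (Finset.range n : Set ℕ) (fun i => uIoc (I i).1 (I i).2)) :
    ∑ i ∈ Finset.range n, dist (a * tent (((I i).1 - q) / b)) (a * tent (((I i).2 - q) / b)) ≤
      2 * a := by
  have hsum : ∑ i ∈ Finset.range n, volume.real (uIoc (I i).1 (I i).2 ∩ Ioc (q - b) (q + b)) ≤
      2 * b := by
    have hfin : ∀ i ∈ Finset.range n,
        volume (uIoc (I i).1 (I i).2 ∩ Ioc (q - b) (q + b)) ≠ ⊤ :=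
      fun i _ => ((measure_mono inter_subset_right).trans_lt (by simp)).ne
    rw [← measureReal_biUnion_finset (h := hfin)]
    · refine (measureReal_mono (s₂ := Ioc (q - b) (q + b)) ?_ ?_).trans ?_
      · exact iUnion₂_subset fun i _ => inter_subset_right
      · simp
      · rw [Real.volume_real_Ioc_of_le (by linarith)]
        linarith
    · exact fun i hi j hj hij =>
        (hI hi hj hij).mono inter_subset_left inter_subset_left
    · exact fun i _ => measurableSet_uIoc.inter measurableSet_Ioc
  calc _ ≤ ∑ i ∈ Finset.range n,
        a / b * volume.real (uIoc (I i).1 (I i).2 ∩ Ioc (q - b) (q + b)) :=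
        Finset.sum_le_sum fun i _ => abs_mul_tent_sub_le_volume ha hb q _ _
    _ ≤ a / b * (2 * b) := by
        rw [← Finset.mul_sum]
        exact mul_le_mul_of_nonneg_left hsum (div_pos ha hb).le
    _ = 2 * a := by field_simp

/-! ### Series of absolutely continuous functions -/

/-- Dominated convergence for series: along families of small total length each term's variation sum
tends to `0` and is dominated by `v n`. The series of these sums therefore tends to `0`, and it
bounds the variation sum of `f`. -/
theorem absolutelyContinuousOnInterval_of_hasSum {g : ℕ → ℝ → ℝ} {f : ℝ → ℝ} {v : ℕ → ℝ}
    {α β : ℝ} (hg : ∀ n, AbsolutelyContinuousOnInterval (g n) α β) (hv : Summable v)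
    (hgv : ∀ n, ∀ E ∈ AbsolutelyContinuousOnInterval.disjWithin α β,
      ∑ i ∈ Finset.range E.1, dist (g n (E.2 i).1) (g n (E.2 i).2) ≤ v n)
    (hf : ∀ x, HasSum (fun n => g n x) (f x)) :
    AbsolutelyContinuousOnInterval f α β := by
  have hE : ∀ᶠ E in AbsolutelyContinuousOnInterval.totalLengthFilter ⊓
      𝓟 (AbsolutelyContinuousOnInterval.disjWithin α β),
      E ∈ AbsolutelyContinuousOnInterval.disjWithin α β :=
    mem_inf_of_right (mem_principal_self _)
  have key : Tendsto (fun E : ℕ × (ℕ → ℝ × ℝ) =>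
      ∑' n, ∑ i ∈ Finset.range E.1, dist (g n (E.2 i).1) (g n (E.2 i).2))
      (AbsolutelyContinuousOnInterval.totalLengthFilter ⊓
        𝓟 (AbsolutelyContinuousOnInterval.disjWithin α β)) (𝓝 (∑' _ : ℕ, (0 : ℝ))) := by
    refine tendsto_tsum_of_dominated_convergence (f := fun (E : ℕ × (ℕ → ℝ × ℝ)) n =>
      ∑ i ∈ Finset.range E.1, dist (g n (E.2 i).1) (g n (E.2 i).2)) hv (fun n => hg n) ?_
    filter_upwards [hE] with E h n
    rw [Real.norm_of_nonneg (Finset.sum_nonneg fun _ _ => dist_nonneg)]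
    exact hgv n E h
  rw [tsum_zero] at key
  refine squeeze_zero' (Eventually.of_forall fun E => Finset.sum_nonneg fun _ _ => dist_nonneg)
    ?_ key
  filter_upwards [hE] with E h
  have hs : Summable fun n => ∑ i ∈ Finset.range E.1, dist (g n (E.2 i).1) (g n (E.2 i).2) :=
    hv.of_nonneg_of_le (fun n => Finset.sum_nonneg fun _ _ => dist_nonneg) fun n => hgv n E h
  have hi : ∀ i ∈ Finset.range E.1, Summable fun n => dist (g n (E.2 i).1) (g n (E.2 i).2) :=
    fun i hi => hs.of_nonneg_of_le (fun n => dist_nonneg) fun n =>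
      Finset.single_le_sum (f := fun i => dist (g n (E.2 i).1) (g n (E.2 i).2))
        (fun _ _ => dist_nonneg) hi
  rw [Summable.tsum_finsetSum hi]
  refine Finset.sum_le_sum fun i hir => ?_
  have hd := (hf (E.2 i).1).sub (hf (E.2 i).2)
  rw [Real.dist_eq, ← hd.tsum_eq]
  have hn : Summable fun n => ‖g n (E.2 i).1 - g n (E.2 i).2‖ := hi i hir
  exact norm_tsum_le_tsum_norm hn

/-! ### Heights and widths of the spikes -/

/-- The breakpoints of the first `n` spikes. -/
noncomputable def breakpoints (q b : ℕ → ℝ) (n : ℕ) : Finset ℝ :=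
  (Finset.range n).biUnion fun k => {q k - b k, q k, q k + b k}

/-- The sum of the slopes of the first `n` spikes. -/
noncomputable def slopeSum (a b : ℕ → ℝ) (n : ℕ) : ℝ :=
  ∑ k ∈ Finset.range n, a k / b k

/-- The sum of the first `n` spikes. -/
noncomputable def partialSpikes (q a b : ℕ → ℝ) (n : ℕ) (x : ℝ) : ℝ :=
  ∑ k ∈ Finset.range n, a k * tent ((x - q k) / b k)

/-- The sum of all spikes. -/
noncomputable def spikeSeries (q a b : ℕ → ℝ) (x : ℝ) : ℝ :=
  ∑' k, a k * tent ((x - q k) / b k)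

/-- The spikes get rapidly lower and steeper: each is much steeper than the sum of the previous
ones, and is low in comparison with the width of the previous one and with the gaps between the
previous breakpoints. -/
structure RapidSpikes (q a b : ℕ → ℝ) : Prop where
  a_pos : ∀ n, 0 < a n
  b_pos : ∀ n, 0 < b n
  a_succ_le : ∀ n, a (n + 1) ≤ b n / 2
  steep : ∀ n : ℕ, ((n : ℝ) + 1) * ((1 + slopeSum a b n) * b n) ≤ a n
  gap : ∀ n, ∀ x ∈ breakpoints q b n, ∀ y ∈ breakpoints q b n, x ≠ y → 512 * a n ≤ |x - y|

theorem Finset.exists_pos_le_abs_sub (F : Finset ℝ) :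
    ∃ ρ : ℝ, 0 < ρ ∧ ∀ x ∈ F, ∀ y ∈ F, x ≠ y → ρ ≤ |x - y| := by
  rcases (F : Set ℝ).subsingleton_or_nontrivial with h | h
  · exact ⟨1, one_pos, fun x hx y hy hxy => (hxy (h hx hy)).elim⟩
  · exact ⟨(F : Set ℝ).infsep, (F.finite_toSet.infsep_pos_iff_nontrivial).2 h,
      fun x hx y hy hxy => by
        have := Set.infsep_le_dist_of_mem (s := (F : Set ℝ)) hx hy hxy
        rwa [Real.dist_eq] at this⟩

/-- The height depends only on earlier data, and the width is then computed from it so that `steep`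
holds with equality. -/
theorem exists_rapidSpikes (q : ℕ → ℝ) : ∃ a b : ℕ → ℝ, RapidSpikes q a b := by
  choose ρ hρ hgap using Finset.exists_pos_le_abs_sub
  -- A state consists of the last width, the breakpoints and the sum of slopes so far.
  let height : ℝ × Finset ℝ × ℝ → ℝ := fun s => min (s.1 / 2) (ρ s.2.1 / 512)
  let width : ℕ → ℝ × Finset ℝ × ℝ → ℝ := fun n s => height s / ((n + 1) * (1 + s.2.2))
  -- The initial `1` is a fictitious width preceding the first spike; it only enters the choice of
  -- the first height.
  let st : ℕ → ℝ × Finset ℝ × ℝ := fun n => Nat.rec (1, ∅, 0) (fun n s =>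
    (width n s, s.2.1 ∪ {q n - width n s, q n, q n + width n s},
      s.2.2 + height s / width n s)) n
  have hst : ∀ n, st (n + 1) = (width n (st n),
      (st n).2.1 ∪ {q n - width n (st n), q n, q n + width n (st n)},
      (st n).2.2 + height (st n) / width n (st n)) := fun n => rfl
  have hF : ∀ n, (st n).2.1 = breakpoints q (fun n => width n (st n)) n := by
    intro n
    induction n with
    | zero => rfl
    | succ n ih =>
      rw [hst, breakpoints, Finset.range_add_one, Finset.biUnion_insert, Finset.union_comm,
        ← breakpoints, ← ih]
  have hL : ∀ n, (st n).2.2 = slopeSum (fun n => height (st n)) (fun n => width n (st n)) n := by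
    intro n
    induction n with
    | zero => simp [slopeSum, st]
    | succ n ih => rw [hst, slopeSum, Finset.sum_range_succ, ← slopeSum, ← ih]
  have hheight : ∀ s : ℝ × Finset ℝ × ℝ, 0 < s.1 → 0 < height s := fun s hs =>
    lt_min (by linarith) (by have := hρ s.2.1; positivity)
  have hpos : ∀ n, 0 < (st n).1 ∧ 0 ≤ (st n).2.2 := by
    intro n
    induction n with
    | zero => simp [st]
    | succ n ih =>
      have h1 := hheight _ ih.1
      have h2 := ih.2
      rw [hst]
      have h3 : 0 < width n (st n) := by positivity
      exact ⟨h3, by positivity⟩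
  have hw : ∀ n, 0 < width n (st n) := fun n => by
    have h1 := hheight _ (hpos n).1
    have h2 := (hpos n).2
    positivity
  refine ⟨fun n => height (st n), fun n => width n (st n), ⟨fun n => hheight _ (hpos n).1, hw,
    fun n => ?_, fun n => ?_, fun n => ?_⟩⟩
  · exact min_le_left _ _
  · rw [← hL]
    have h2 := (hpos n).2
    refine le_of_eq ?_
    change _ * (_ * (height (st n) / _)) = _
    field_simp
  · rw [← hF]
    intro x hx y hy hxy
    have h1 := hgap _ x hx y hy hxy
    have h2 : height (st n) ≤ ρ (st n).2.1 / 512 := min_le_right _ _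
    change 512 * height (st n) ≤ _
    linarith

namespace RapidSpikes

variable {q a b : ℕ → ℝ}

theorem slopeSum_nonneg (h : RapidSpikes q a b) (n : ℕ) : 0 ≤ slopeSum a b n :=
  Finset.sum_nonneg fun k _ => (div_pos (h.a_pos k) (h.b_pos k)).le

theorem b_le_a (h : RapidSpikes q a b) (n : ℕ) : b n ≤ a n := by
  refine le_trans ?_ (h.steep n)
  have h1 := h.slopeSum_nonneg n
  have h2 := h.b_pos n
  have h3 : (0 : ℝ) ≤ n := n.cast_nonneg
  have h4 : 0 ≤ (1 + slopeSum a b n) * b n := by positivity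
  nlinarith [mul_nonneg h1 h2.le, mul_nonneg h3 h4]

/-- Heights at least halve, as `a (n + 1) ≤ b n / 2 ≤ a n / 2`. The unreduced right side matches
`hasSum_geometric_two'`. -/
theorem a_add_le (h : RapidSpikes q a b) (n k : ℕ) : a (k + n) ≤ 2 * a n / 2 / 2 ^ k := by
  induction k with
  | zero => simp
  | succ k ih =>
    have h1 := h.a_succ_le (k + n)
    have h2 := h.b_le_a (k + n)
    rw [add_right_comm, pow_succ, ← div_div]
    linarith

theorem summable_a_add (h : RapidSpikes q a b) (n : ℕ) : Summable fun k => a (k + n) :=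
  (hasSum_geometric_two' (2 * a n)).summable.of_nonneg_of_le (fun _ => (h.a_pos _).le)
    (h.a_add_le n)

theorem summable_a (h : RapidSpikes q a b) : Summable a := h.summable_a_add 0

theorem tsum_a_add_le (h : RapidSpikes q a b) (n : ℕ) : ∑' k, a (k + n) ≤ 2 * a n :=
  ((h.summable_a_add n).tsum_le_tsum (h.a_add_le n)
    (hasSum_geometric_two' (2 * a n)).summable).trans_eq (hasSum_geometric_two' (2 * a n)).tsum_eq

theorem tendsto_a (h : RapidSpikes q a b) : Tendsto a atTop (𝓝 0) :=
  h.summable_a.tendsto_atTop_zero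

theorem tendsto_b (h : RapidSpikes q a b) : Tendsto b atTop (𝓝 0) :=
  squeeze_zero (fun n => (h.b_pos n).le) h.b_le_a h.tendsto_a

theorem mul_tent_nonneg (h : RapidSpikes q a b) (n : ℕ) (x : ℝ) :
    0 ≤ a n * tent ((x - q n) / b n) :=
  mul_nonneg (h.a_pos n).le (tent_nonneg _)

theorem mul_tent_le (h : RapidSpikes q a b) (n : ℕ) (x : ℝ) :
    a n * tent ((x - q n) / b n) ≤ a n :=
  mul_le_of_le_one_right (h.a_pos n).le (tent_le_one _)

theorem summable_spikes (h : RapidSpikes q a b) (x : ℝ) :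
    Summable fun n => a n * tent ((x - q n) / b n) :=
  h.summable_a.of_nonneg_of_le (fun n => h.mul_tent_nonneg n x) fun n => h.mul_tent_le n x

theorem hasSum_spikeSeries (h : RapidSpikes q a b) (x : ℝ) :
    HasSum (fun n => a n * tent ((x - q n) / b n)) (spikeSeries q a b x) :=
  (h.summable_spikes x).hasSum

theorem continuous_spikeSeries (h : RapidSpikes q a b) : Continuous (spikeSeries q a b) := by
  refine continuous_tsum (u := a) (fun n => ?_) h.summable_a fun n x => ?_
  · exact continuous_const.mul (continuous_tent.comp (by fun_prop))
  · rw [Real.norm_of_nonneg (h.mul_tent_nonneg n x)]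
    exact h.mul_tent_le n x

theorem partialSpikes_le (h : RapidSpikes q a b) (n : ℕ) (x : ℝ) :
    partialSpikes q a b n x ≤ spikeSeries q a b x :=
  (h.summable_spikes x).sum_le_tsum _ fun k _ => h.mul_tent_nonneg k x

theorem spikeSeries_le (h : RapidSpikes q a b) (n : ℕ) (x : ℝ) :
    spikeSeries q a b x ≤ partialSpikes q a b n x + 2 * a n := by
  rw [spikeSeries, ← (h.summable_spikes x).sum_add_tsum_nat_add n, partialSpikes]
  gcongr
  refine le_trans ?_ (h.tsum_a_add_le n)
  exact ((summable_nat_add_iff n).2 (h.summable_spikes x)).tsum_le_tsum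
    (fun k => h.mul_tent_le (k + n) x) (h.summable_a_add n)

theorem abs_partialSpikes_sub_le (h : RapidSpikes q a b) (n : ℕ) (x y : ℝ) :
    |partialSpikes q a b n x - partialSpikes q a b n y| ≤ slopeSum a b n * |x - y| := by
  rw [partialSpikes, partialSpikes, ← Finset.sum_sub_distrib, slopeSum, Finset.sum_mul]
  exact (Finset.abs_sum_le_sum_abs _ _).trans
    (Finset.sum_le_sum fun k _ => abs_mul_tent_sub_le (h.a_pos k) (h.b_pos k) _ _ _)

theorem absolutelyContinuousOnInterval (h : RapidSpikes q a b) (α β : ℝ) :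
    AbsolutelyContinuousOnInterval (spikeSeries q a b) α β := by
  refine absolutelyContinuousOnInterval_of_hasSum (v := fun n => 2 * a n) (fun n => ?_)
    (h.summable_a.mul_left 2) (fun n E hE => ?_) h.hasSum_spikeSeries
  · have hK : LipschitzWith (Real.toNNReal (a n / b n))
        fun x => a n * tent ((x - q n) / b n) :=
      LipschitzWith.of_dist_le_mul fun x y => by
        rw [Real.coe_toNNReal _ (div_pos (h.a_pos n) (h.b_pos n)).le, Real.dist_eq, Real.dist_eq]
        exact abs_mul_tent_sub_le (h.a_pos n) (h.b_pos n) _ _ _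
    exact (hK.lipschitzOnWith (s := uIcc α β)).absolutelyContinuousOnInterval
  · exact sum_abs_mul_tent_sub_le (h.a_pos n) (h.b_pos n) (q n) E.1 E.2 hE.2

end RapidSpikes

/-! ### Strong porosity -/

theorem exists_half_interval_notMem {u v : ℝ} (huv : u < v) (c : ℝ) :
    ∃ u' v', u ≤ u' ∧ v' ≤ v ∧ v' - u' = (v - u) / 2 ∧ c ∉ Ioo u' v' := by
  rcases le_total c ((u + v) / 2) with h | h
  · exact ⟨(u + v) / 2, v, by linarith, le_rfl, by ring, fun hc => by linarith [hc.1]⟩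
  · exact ⟨u, (u + v) / 2, le_rfl, by linarith, by ring, fun hc => by linarith [hc.2]⟩

/-- The separation leaves at most one point of `F` in the open interval, so a single halving
suffices. -/
theorem exists_half_interval_forall_notMem {u v : ℝ} (huv : u < v) {F : Finset ℝ}
    (hF : ∀ x ∈ F, ∀ y ∈ F, x ≠ y → v - u ≤ |x - y|) :
    ∃ u' v', u ≤ u' ∧ v' ≤ v ∧ v' - u' = (v - u) / 2 ∧ ∀ c ∈ F, c ∉ Ioo u' v' := by
  by_cases hc : ∃ c ∈ F, c ∈ Ioo u v
  · obtain ⟨c, hcF, hc⟩ := hc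
    obtain ⟨u', v', hu, hv, hl, hcn⟩ := exists_half_interval_notMem huv c
    refine ⟨u', v', hu, hv, hl, fun d hd hdn => ?_⟩
    by_cases hcd : c = d
    · exact hcn (hcd ▸ hdn)
    · have h1 := hF c hcF d hd hcd
      have h2 : |c - d| < v - u := by
        rw [abs_lt]
        constructor <;> linarith [hc.1, hc.2, hdn.1, hdn.2]
      linarith
  · push Not at hc
    exact ⟨u, (u + v) / 2, le_rfl, by linarith, by ring, fun c hcF h =>
      hc c hcF ⟨h.1, by linarith [h.2]⟩⟩

theorem mul_tent_affineOn {b : ℝ} (hb : 0 < b) (a q : ℝ) {u v : ℝ}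
    (h₁ : q - b ∉ Ioo u v) (h₂ : q ∉ Ioo u v) (h₃ : q + b ∉ Ioo u v) :
    ∃ s t : ℝ, ∀ x ∈ Icc u v, a * tent ((x - q) / b) = s * x + t := by
  simp only [mul_tent_eq hb]
  have split : ∀ c, c ∉ Ioo u v → c ≤ u ∨ v ≤ c := fun c hc => by
    by_contra hcon
    push Not at hcon
    exact hc hcon
  rcases split _ h₁ with k₁ | k₁
  · rcases split _ h₂ with k₂ | k₂
    · rcases split _ h₃ with k₃ | k₃
      · refine ⟨0, 0, fun x hx => ?_⟩
        rw [abs_of_nonneg (by linarith [hx.1]), max_eq_left (by linarith [hx.1])]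
        ring
      · refine ⟨-(a / b), a / b * (b + q), fun x hx => ?_⟩
        rw [abs_of_nonneg (by linarith [hx.1]), max_eq_right (by linarith [hx.2])]
        ring
    · refine ⟨a / b, a / b * (b - q), fun x hx => ?_⟩
      rw [abs_of_nonpos (by linarith [hx.2]), max_eq_right (by linarith [hx.1])]
      ring
  · refine ⟨0, 0, fun x hx => ?_⟩
    rw [abs_of_nonpos (by linarith [hx.2]), max_eq_left (by linarith [hx.2])]
    ring

theorem RapidSpikes.partialSpikes_affineOn {q a b : ℕ → ℝ} (h : RapidSpikes q a b) (n : ℕ)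
    {u v : ℝ} (hF : ∀ c ∈ breakpoints q b n, c ∉ Ioo u v) :
    ∃ s t : ℝ, ∀ x ∈ Icc u v, partialSpikes q a b n x = s * x + t := by
  have key : ∀ k ∈ Finset.range n, ∃ s t : ℝ, ∀ x ∈ Icc u v,
      a k * tent ((x - q k) / b k) = s * x + t := by
    intro k hk
    have hmem : ∀ c ∈ ({q k - b k, q k, q k + b k} : Finset ℝ), c ∉ Ioo u v := fun c hc =>
      hF c (Finset.mem_biUnion.2 ⟨k, hk, hc⟩)
    exact mul_tent_affineOn (h.b_pos k) _ _ (hmem _ (by simp)) (hmem _ (by simp))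
      (hmem _ (by simp))
  choose! s t hst using key
  refine ⟨∑ k ∈ Finset.range n, s k, ∑ k ∈ Finset.range n, t k, fun x hx => ?_⟩
  rw [partialSpikes, Finset.sum_mul, ← Finset.sum_add_distrib]
  exact Finset.sum_congr rfl fun k hk => hst k hk x hx

theorem EuclideanSpace.abs_apply_sub_le_dist {ι : Type*} [Fintype ι] (x y : EuclideanSpace ℝ ι)
    (i : ι) : |x i - y i| ≤ dist x y := by
  rw [dist_eq_norm, ← Real.norm_eq_abs, ← PiLp.sub_apply]
  exact PiLp.norm_apply_le (x - y) i

theorem EuclideanSpace.dist_le_abs_add_abs (x y : EuclideanSpace ℝ (Fin 2)) :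
    dist x y ≤ |x 0 - y 0| + |x 1 - y 1| := by
  rw [EuclideanSpace.dist_eq, Fin.sum_univ_two, Real.dist_eq, Real.dist_eq]
  refine Real.sqrt_le_iff.2 ⟨by positivity, ?_⟩
  nlinarith [abs_nonneg (x 0 - y 0), abs_nonneg (x 1 - y 1)]

/-- If `f` is close to an affine function on an interval, then the graph of `f` misses a ball of
comparable size at any prescribed height. -/
theorem exists_closedBall_disjoint_unitGraph {f : ℝ → ℝ} {u w s t : ℝ} (hw : 0 < w)
    (hlow : ∀ x ∈ Icc u (u + w), s * x + t ≤ f x)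
    (hupp : ∀ x ∈ Icc u (u + w), f x ≤ s * x + t + w / 16) (y₀ : ℝ) :
    ∃ y : EuclideanSpace ℝ (Fin 2), y 0 ∈ Icc u (u + w) ∧ |y 1 - y₀| ≤ w / 4 ∧
      ∀ z ∈ Metric.closedBall y (w / 8), z ∉ unitGraph f := by
  -- The balls around opposite corners cannot both meet the graph of a monotone function.
  have main : ∀ ε : ℝ, |ε| = 1 → 0 ≤ ε * s →
      ∃ y : EuclideanSpace ℝ (Fin 2), y 0 ∈ Icc u (u + w) ∧ |y 1 - y₀| ≤ w / 4 ∧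
      ∀ z ∈ Metric.closedBall y (w / 8), z ∉ unitGraph f := by
    intro ε hε hs
    by_contra! hcon
    obtain ⟨z₁, hz₁, x₁, -, rfl⟩ := hcon !₂[u + w / 4, y₀ + ε * (w / 4)]
      (by simp; constructor <;> linarith)
      (by simp [abs_mul, hε, abs_of_pos (by positivity : 0 < w / 4)])
    obtain ⟨z₂, hz₂, x₂, -, rfl⟩ := hcon !₂[u + 3 * w / 4, y₀ - ε * (w / 4)]
      (by simp; constructor <;> linarith)
      (by simp [abs_mul, hε, abs_of_pos (by positivity : 0 < w / 4)])
    have a₁ := (EuclideanSpace.abs_apply_sub_le_dist _ _ 0).trans hz₁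
    have b₁ := (EuclideanSpace.abs_apply_sub_le_dist _ _ 1).trans hz₁
    have a₂ := (EuclideanSpace.abs_apply_sub_le_dist _ _ 0).trans hz₂
    have b₂ := (EuclideanSpace.abs_apply_sub_le_dist _ _ 1).trans hz₂
    simp only [Matrix.cons_val_zero, Matrix.cons_val_one, abs_le] at a₁ b₁ a₂ b₂
    have m₁ : x₁ ∈ Icc u (u + w) := ⟨by linarith, by linarith⟩
    have m₂ : x₂ ∈ Icc u (u + w) := ⟨by linarith, by linarith⟩
    have := hlow _ m₁
    have := hlow _ m₂
    have := hupp _ m₁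
    have := hupp _ m₂
    have hx : x₁ ≤ x₂ := by linarith
    rcases (abs_eq zero_le_one).1 hε with rfl | rfl
    · nlinarith
    · nlinarith
  rcases le_total 0 s with hs | hs
  · exact main 1 (by simp) (by linarith)
  · exact main (-1) (by simp) (by linarith)

theorem RapidSpikes.isStronglyPorous {q a b : ℕ → ℝ} (h : RapidSpikes q a b) :
    IsStronglyPorous (unitGraph (spikeSeries q a b)) := by
  refine ⟨1 / 128, by norm_num, fun x r hr _ => ?_⟩
  have hex : ∃ n, a (n + 1) ≤ r / 512 :=
    (((tendsto_add_atTop_iff_nat 1).2 h.tendsto_a).eventually_le_const (by positivity)).exists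
  classical
  -- The critical scale: spikes after the `n`-th are negligible, while by minimality `a n > r / 512`
  -- if `n > 0`, which spreads the breakpoints of the first `n` spikes at least `r` apart.
  let n := Nat.find hex
  have hn : a (n + 1) ≤ r / 512 := Nat.find_spec hex
  have hgap : ∀ c ∈ breakpoints q b n, ∀ d ∈ breakpoints q b n, c ≠ d → r ≤ |c - d| := by
    intro c hc d hd hcd
    rcases Nat.eq_zero_or_pos n with h0 | h0
    · rw [h0] at hc
      simp [breakpoints] at hc
    · have h1 := Nat.find_min hex (m := n - 1) (Nat.sub_one_lt h0.ne')
      rw [Nat.sub_add_cancel h0, not_le] at h1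
      linarith [h.gap n c hc d hd hcd]
  obtain ⟨u₁, v₁, hu₁, hv₁, hl₁, hF⟩ :=
    exists_half_interval_forall_notMem (u := x 0 - r / 2) (v := x 0 + r / 2) (by linarith)
      (F := breakpoints q b n) (by simpa [sub_add_eq_sub_sub] using hgap)
  -- The `n`-th spike itself is not controlled by the gap condition; three more halvings avoid its
  -- breakpoints, leaving length `r / 16`.
  obtain ⟨u₂, v₂, hu₂, hv₂, hl₂, hc₂⟩ :=
    exists_half_interval_notMem (u := u₁) (v := v₁) (by linarith) (q n - b n)
  obtain ⟨u₃, v₃, hu₃, hv₃, hl₃, hc₃⟩ :=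
    exists_half_interval_notMem (u := u₂) (v := v₂) (by linarith) (q n)
  obtain ⟨u, v, hu, hv, hl, hc⟩ :=
    exists_half_interval_notMem (u := u₃) (v := v₃) (by linarith) (q n + b n)
  have hwr : v = u + r / 16 := by linarith
  have hall : ∀ c ∈ breakpoints q b (n + 1), c ∉ Ioo u v := by
    intro c hcF hcm
    rw [breakpoints, Finset.range_add_one, Finset.biUnion_insert, ← breakpoints] at hcF
    simp only [Finset.mem_union, Finset.mem_insert, Finset.mem_singleton] at hcF
    rcases hcF with (rfl | rfl | rfl) | hcF
    · exact hc₂ ⟨by linarith [hcm.1], by linarith [hcm.2]⟩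
    · exact hc₃ ⟨by linarith [hcm.1], by linarith [hcm.2]⟩
    · exact hc hcm
    · exact hF c hcF ⟨by linarith [hcm.1], by linarith [hcm.2]⟩
  obtain ⟨s, t, hst⟩ := h.partialSpikes_affineOn (n + 1) hall
  subst hwr
  -- The tail is at most `2 * a (n + 1) ≤ r / 256`, which is `w / 16` for `w = r / 16`.
  obtain ⟨y, hy₀, hy₁, hy⟩ := exists_closedBall_disjoint_unitGraph
    (f := spikeSeries q a b) (w := r / 16) (by positivity)
    (fun z hz => hst z hz ▸ h.partialSpikes_le (n + 1) z)
    (fun z hz => by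
      rw [← hst z hz]
      linarith [h.spikeSeries_le (n + 1) z]) (x 1)
  refine ⟨y, fun z hz => ?_⟩
  rw [show 1 / 128 * r = r / 16 / 8 by ring] at hz
  refine ⟨?_, hy z hz⟩
  have h1 : |y 0 - x 0| ≤ r / 2 := by
    rw [abs_le]
    constructor <;> linarith [hy₀.1, hy₀.2]
  have h2 := EuclideanSpace.dist_le_abs_add_abs y x
  have h3 := dist_triangle z y x
  rw [Metric.mem_closedBall] at hz ⊢
  linarith

/-! ### Monotone subsets of the graph -/

/-- In a monotone order, a point outside an arc in which the space is dense cannot separate the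
end points of the arc. -/
theorem lt_iff_lt_of_notMem_Icc {M : Type*} [LinearOrder M] {e : M → ℝ} {D : ℝ → ℝ → ℝ}
    (hD : Continuous (Function.uncurry D)) (hself : ∀ x, D x x = 0)
    (hpos : ∀ x y, x ≠ y → 0 < D x y) {c : ℝ}
    (hc : ∀ x y z : M, x < y → y < z → D (e x) (e y) ≤ c * D (e x) (e z)) {s t w : M}
    (hst : e s ≤ e t) (hdense : Icc (e s) (e t) ⊆ closure (range e ∩ Icc (e s) (e t)))
    (hw : e w ∉ Icc (e s) (e t)) : s < w ↔ t < w := by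
  let A : Set ℝ := e '' {m | m < w} ∩ Icc (e s) (e t)
  let B : Set ℝ := e '' {m | w < m} ∩ Icc (e s) (e t)
  have hcover : Icc (e s) (e t) ⊆ closure A ∪ closure B := by
    rw [← closure_union]
    refine hdense.trans (closure_mono ?_)
    rintro _ ⟨⟨m, rfl⟩, hm⟩
    rcases lt_trichotomy m w with h | h | h
    · exact Or.inl ⟨⟨m, h, rfl⟩, hm⟩
    · exact (hw (h ▸ hm)).elim
    · exact Or.inr ⟨⟨m, h, rfl⟩, hm⟩
  have hs : e s ∈ Icc (e s) (e t) := left_mem_Icc.2 hst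
  have ht : e t ∈ Icc (e s) (e t) := right_mem_Icc.2 hst
  have hA : ∀ m, e m ∈ Icc (e s) (e t) → m < w → (Icc (e s) (e t) ∩ closure A).Nonempty :=
    fun m hm h => ⟨e m, hm, subset_closure ⟨⟨m, h, rfl⟩, hm⟩⟩
  have hB : ∀ m, e m ∈ Icc (e s) (e t) → ¬ m < w → (Icc (e s) (e t) ∩ closure B).Nonempty :=
    fun m hm h => ⟨e m, hm, subset_closure ⟨⟨m, (not_lt.1 h).lt_of_ne
      fun hmw => hw (hmw ▸ hm), rfl⟩, hm⟩⟩
  by_contra hcon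
  have hAB : (Icc (e s) (e t) ∩ closure A).Nonempty ∧ (Icc (e s) (e t) ∩ closure B).Nonempty := by
    by_cases h : s < w
    · exact ⟨hA s hs h, hB t ht fun h' => hcon (by simp [h, h'])⟩
    · exact ⟨hA t ht (by by_contra h'; exact hcon (by simp [h, h'])), hB s hs h⟩
  -- At a common limit `z` of points below and above `w`, the inequality `D x w ≤ c * D x y` with
  -- `x` and `y` tending to `z` forces `D z w ≤ 0`.
  obtain ⟨z, hz, hzA, hzB⟩ := isPreconnected_closed_iff.1 isPreconnected_Icc _ _ isClosed_closure
    isClosed_closure hcover hAB.1 hAB.2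
  have hclosed : IsClosed {p : ℝ × ℝ | D p.1 (e w) ≤ c * D p.1 p.2} :=
    isClosed_le (hD.comp (continuous_fst.prodMk continuous_const)) (continuous_const.mul hD)
  have hsub : A ×ˢ B ⊆ {p : ℝ × ℝ | D p.1 (e w) ≤ c * D p.1 p.2} := by
    rintro ⟨_, _⟩ ⟨⟨⟨x, hx, rfl⟩, -⟩, ⟨⟨y, hy, rfl⟩, -⟩⟩
    exact hc x w y hx hy
  have hmem : (z, z) ∈ closure (A ×ˢ B) := by
    rw [closure_prod_eq]
    exact ⟨hzA, hzB⟩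
  have hle : D z (e w) ≤ c * D z z := closure_minimal hsub hclosed hmem
  rw [hself, mul_zero] at hle
  exact absurd (hpos z (e w) fun h => hw (h ▸ hz)) (not_lt.2 hle)

theorem Icc_subset_closure_inter_of_Ioo_subset_closure {S : Set ℝ} {u v s t : ℝ}
    (hS : Ioo u v ⊆ closure S) (hst : s < t) (hs : u < s) (ht : t < v) :
    Icc s t ⊆ closure (S ∩ Icc s t) := by
  refine (closure_Ioo hst.ne).superset.trans (closure_minimal (fun x hx => ?_) isClosed_closure)
  have hx' : x ∈ closure (Ioo s t ∩ S) :=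
    isOpen_Ioo.inter_closure ⟨hx, hS ⟨hs.trans hx.1, hx.2.trans ht⟩⟩
  have hsub : Ioo s t ∩ S ⊆ S ∩ Icc s t := fun y hy => ⟨hy.2, Ioo_subset_Icc_self hy.1⟩
  exact closure_mono hsub hx'

/-- A monotone order on a dense subset of an arc is the order of the arc or its reverse. -/
theorem lt_lt_or_lt_lt_of_monotone {M : Type*} [LinearOrder M] {e : M → ℝ} {D : ℝ → ℝ → ℝ}
    (hD : Continuous (Function.uncurry D)) (hself : ∀ x, D x x = 0)
    (hpos : ∀ x y, x ≠ y → 0 < D x y) {c : ℝ}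
    (hc : ∀ x y z : M, x < y → y < z → D (e x) (e y) ≤ c * D (e x) (e z)) {u v : ℝ}
    (hdense : Ioo u v ⊆ closure (range e)) {l p r : M} (hul : u < e l) (hlp : e l < e p)
    (hpr : e p < e r) (hrv : e r < v) : l < p ∧ p < r ∨ r < p ∧ p < l := by
  have h1 : p < l ↔ r < l := lt_iff_lt_of_notMem_Icc hD hself hpos hc hpr.le
    (Icc_subset_closure_inter_of_Ioo_subset_closure hdense hpr (hul.trans hlp) hrv)
    fun h => absurd h.1 (not_le.2 hlp)
  have h2 : l < r ↔ p < r := lt_iff_lt_of_notMem_Icc hD hself hpos hc hlp.le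
    (Icc_subset_closure_inter_of_Ioo_subset_closure hdense hlp hul (hpr.trans hrv))
    fun h => absurd h.2 (not_le.2 hpr)
  have hlp' : l ≠ p := fun h => hlp.ne (congrArg e h)
  have hpr' : p ≠ r := fun h => hpr.ne (congrArg e h)
  have hlr' : l ≠ r := fun h => (hlp.trans hpr).ne (congrArg e h)
  rcases lt_or_gt_of_ne hlr' with h | h
  · exact Or.inl ⟨hlp'.lt_of_le (not_lt.1 fun h' => lt_asymm h (h1.1 h')), h2.1 h⟩
  · exact Or.inr ⟨hpr'.symm.lt_of_le (not_lt.1 fun h' => lt_asymm h (h2.2 h')), h1.2 h⟩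

/-- The distance in the plane between two points of the graph of `f`. -/
noncomputable def graphDist (f : ℝ → ℝ) (x y : ℝ) : ℝ :=
  dist (!₂[x, f x] : EuclideanSpace ℝ (Fin 2)) !₂[y, f y]

theorem continuous_graphPoint {f : ℝ → ℝ} (hf : Continuous f) :
    Continuous fun x : ℝ => (!₂[x, f x] : EuclideanSpace ℝ (Fin 2)) := by
  refine (PiLp.continuous_toLp 2 _).comp (continuous_pi fun i => ?_)
  fin_cases i
  · exact continuous_id
  · exact hf

theorem continuous_graphDist {f : ℝ → ℝ} (hf : Continuous f) :
    Continuous (Function.uncurry (graphDist f)) :=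
  ((continuous_graphPoint hf).comp continuous_fst).dist
    ((continuous_graphPoint hf).comp continuous_snd)

theorem graphDist_comm (f : ℝ → ℝ) (x y : ℝ) : graphDist f x y = graphDist f y x :=
  dist_comm _ _

theorem abs_sub_le_graphDist (f : ℝ → ℝ) (x y : ℝ) : |x - y| ≤ graphDist f x y := by
  simpa [graphDist] using EuclideanSpace.abs_apply_sub_le_dist
    (!₂[x, f x] : EuclideanSpace ℝ (Fin 2)) !₂[y, f y] 0

theorem abs_apply_sub_le_graphDist (f : ℝ → ℝ) (x y : ℝ) : |f x - f y| ≤ graphDist f x y := by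
  simpa [graphDist] using EuclideanSpace.abs_apply_sub_le_dist
    (!₂[x, f x] : EuclideanSpace ℝ (Fin 2)) !₂[y, f y] 1

theorem graphDist_le (f : ℝ → ℝ) (x y : ℝ) : graphDist f x y ≤ |x - y| + |f x - f y| := by
  simpa [graphDist] using EuclideanSpace.dist_le_abs_add_abs
    (!₂[x, f x] : EuclideanSpace ℝ (Fin 2)) !₂[y, f y]

/-- A subset of the graph that is not nowhere dense projects to a dense subset of an interval. -/
theorem exists_Ioo_subset_closure_of_not_isNowhereDense {f : ℝ → ℝ} (hf : Continuous f)
    {M : Set (unitGraph f)} (hM : ¬ IsNowhereDense M) :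
    ∃ u v : ℝ, 0 ≤ u ∧ v ≤ 1 ∧ u < v ∧ Ioo u v ⊆ closure (range fun m : M => m.1.1 0) := by
  obtain ⟨⟨_, x₀, hx₀, rfl⟩, hg⟩ := nonempty_iff_ne_empty.2 hM
  let φ : Icc (0 : ℝ) 1 → unitGraph f := fun x => ⟨!₂[x.1, f x.1], x.1, x.2, rfl⟩
  have hφ : Continuous φ :=
    ((continuous_graphPoint hf).comp continuous_subtype_val).subtype_mk _
  obtain ⟨V, hVo, hV⟩ : ∃ V : Set ℝ, IsOpen V ∧
      Subtype.val ⁻¹' V = φ ⁻¹' interior (closure M) :=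
    isOpen_induced_iff.1 (isOpen_interior.preimage hφ)
  have hx₀V : x₀ ∈ V := by
    have : (⟨x₀, hx₀⟩ : Icc (0 : ℝ) 1) ∈ φ ⁻¹' interior (closure M) := hg
    rw [← hV] at this
    exact this
  -- The point `x₀` may be an end point of `[0, 1]`; a nearby interior point replaces it.
  obtain ⟨x₁, hx₁V, hx₁⟩ : (V ∩ Ioo (0 : ℝ) 1).Nonempty := by
    rw [← closure_Ioo zero_ne_one, mem_closure_iff] at hx₀
    exact hx₀ V hVo hx₀V
  obtain ⟨u, v, hx₁uv, huv⟩ := mem_nhds_iff_exists_Ioo_subset.1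
    ((hVo.inter isOpen_Ioo).mem_nhds ⟨hx₁V, hx₁⟩)
  have huv' : u < v := hx₁uv.1.trans hx₁uv.2
  have hIoo : Ioo u v ⊆ Icc 0 1 := fun y hy => Ioo_subset_Icc_self (huv hy).2
  have hIcc := closure_minimal hIoo isClosed_Icc
  rw [closure_Ioo huv'.ne, Icc_subset_Icc_iff huv'.le] at hIcc
  refine ⟨u, v, hIcc.1, hIcc.2, huv', fun y hy => ?_⟩
  have hφy : φ ⟨y, hIoo hy⟩ ∈ closure M := by
    have : (⟨y, hIoo hy⟩ : Icc (0 : ℝ) 1) ∈ Subtype.val ⁻¹' V := (huv hy).1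
    rw [hV] at this
    exact interior_subset this
  have hproj : Continuous fun m : unitGraph f => m.1 0 := by fun_prop
  have hsub : (fun m : unitGraph f => m.1 0) '' M ⊆ range fun m : M => m.1.1 0 := by
    rintro _ ⟨m, hm, rfl⟩
    exact ⟨⟨m, hm⟩, rfl⟩
  exact closure_mono hsub (image_closure_subset_closure_image hproj (mem_image_of_mem _ hφy))

/-- Spikes persist under small perturbations of their three points. -/
theorem exists_spike_mem_of_dense {f : ℝ → ℝ} (hf : Continuous f) {S : Set ℝ} {u v c x y z : ℝ}
    (hS : Ioo u v ⊆ closure S) (hux : u < x) (hxy : x < y) (hyz : y < z) (hzv : z < v)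
    (h₁ : c * graphDist f x z < graphDist f x y) (h₂ : c * graphDist f z x < graphDist f z y) :
    ∃ x' ∈ S, ∃ y' ∈ S, ∃ z' ∈ S, u < x' ∧ x' < y' ∧ y' < z' ∧ z' < v ∧
      c * graphDist f x' z' < graphDist f x' y' ∧ c * graphDist f z' x' < graphDist f z' y' := by
  have hD : ∀ g k : ℝ × ℝ × ℝ → ℝ, Continuous g → Continuous k →
      Continuous fun p => graphDist f (g p) (k p) := fun g k hg hk =>
    ((continuous_graphPoint hf).comp hg).dist ((continuous_graphPoint hf).comp hk)
  have k₁ : Continuous fun p : ℝ × ℝ × ℝ => p.1 := by fun_prop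
  have k₂ : Continuous fun p : ℝ × ℝ × ℝ => p.2.1 := by fun_prop
  have k₃ : Continuous fun p : ℝ × ℝ × ℝ => p.2.2 := by fun_prop
  -- All required inequalities are strict, hence open in the triple, and the triple is a limit of
  -- triples from `S`.
  have hmem : (x, y, z) ∈ closure (S ×ˢ (S ×ˢ S)) := by
    rw [closure_prod_eq, closure_prod_eq]
    exact ⟨hS ⟨hux, by linarith⟩, hS ⟨by linarith, by linarith⟩, hS ⟨by linarith, hzv⟩⟩
  have hlt : ∀ g k : ℝ × ℝ × ℝ → ℝ, Continuous g → Continuous k → g (x, y, z) < k (x, y, z) →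
      ∀ᶠ p in 𝓝 (x, y, z), g p < k p := fun g k hg hk h =>
    hg.continuousAt.eventually_lt hk.continuousAt h
  have hev : ∀ᶠ p : ℝ × ℝ × ℝ in 𝓝 (x, y, z), u < p.1 ∧ p.1 < p.2.1 ∧ p.2.1 < p.2.2 ∧
      p.2.2 < v ∧ c * graphDist f p.1 p.2.2 < graphDist f p.1 p.2.1 ∧
      c * graphDist f p.2.2 p.1 < graphDist f p.2.2 p.2.1 := by
    filter_upwards [hlt (fun _ => u) (fun p => p.1) continuous_const k₁ hux,
      hlt (fun p => p.1) (fun p => p.2.1) k₁ k₂ hxy, hlt (fun p => p.2.1) (fun p => p.2.2) k₂ k₃ hyz,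
      hlt (fun p => p.2.2) (fun _ => v) k₃ continuous_const hzv,
      hlt (fun p => c * graphDist f p.1 p.2.2) (fun p => graphDist f p.1 p.2.1)
        (continuous_const.mul (hD _ _ k₁ k₃)) (hD _ _ k₁ k₂) h₁,
      hlt (fun p => c * graphDist f p.2.2 p.1) (fun p => graphDist f p.2.2 p.2.1)
        (continuous_const.mul (hD _ _ k₃ k₁)) (hD _ _ k₃ k₂) h₂] with p e₁ e₂ e₃ e₄ e₅ e₆
    exact ⟨e₁, e₂, e₃, e₄, e₅, e₆⟩
  obtain ⟨p, ⟨hp₁, hp₂, hp₃⟩, hp⟩ := ((mem_closure_iff_frequently.1 hmem).and_eventually hev).exists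
  exact ⟨p.1, hp₁, p.2.1, hp₂, p.2.2, hp₃, hp⟩

/-- If arbitrarily steep spikes of the graph of `f` occur in every interval, then every monotone
subset of the graph is nowhere dense. -/
theorem isNowhereDense_of_isMonotoneSpace {f : ℝ → ℝ} (hf : Continuous f)
    (hspike : ∀ u v c : ℝ, 0 ≤ u → v ≤ 1 → u < v → 0 < c → ∃ x y z : ℝ,
      u < x ∧ x < y ∧ y < z ∧ z < v ∧ c * graphDist f x z < graphDist f x y ∧
        c * graphDist f z x < graphDist f z y)
    (M : Set (unitGraph f)) (hM : IsMonotoneSpace M) : IsNowhereDense M := by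
  obtain ⟨_, c, hc, hmono⟩ := hM
  by_contra hcon
  obtain ⟨u, v, hu, hv, huv, hdense⟩ := exists_Ioo_subset_closure_of_not_isNowhereDense hf hcon
  let e : M → ℝ := fun m => m.1.1 0
  have hpt : ∀ m : M, (!₂[e m, f (e m)] : EuclideanSpace ℝ (Fin 2)) = m.1.1 := by
    rintro ⟨⟨_, x, hx, rfl⟩, hm⟩
    rfl
  have hdist : ∀ m m' : M, dist m m' = graphDist f (e m) (e m') := by
    intro m m'
    rw [graphDist, hpt, hpt]
    rfl
  have hmono' : ∀ x y z : M, x < y → y < z →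
      graphDist f (e x) (e y) ≤ c * graphDist f (e x) (e z) := by
    intro x y z hxy hyz
    rw [← hdist, ← hdist]
    exact hmono x y z hxy hyz
  obtain ⟨x, y, z, hux, hxy, hyz, hzv, h₁, h₂⟩ := hspike u v c hu hv huv hc
  obtain ⟨_, ⟨l, rfl⟩, _, ⟨p, rfl⟩, _, ⟨r, rfl⟩, hul, hlp, hpr, hrv, k₁, k₂⟩ :=
    exists_spike_mem_of_dense hf hdense hux hxy hyz hzv h₁ h₂
  -- The order may run either way along the arc, which is why the spike must be steep as seen from
  -- both feet.
  rcases lt_lt_or_lt_lt_of_monotone (continuous_graphDist hf) (fun x => dist_self _)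
    (fun x y hxy => (abs_pos.2 (sub_ne_zero.2 hxy)).trans_le (abs_sub_le_graphDist f x y))
    hmono' hdense hul hlp hpr hrv with ⟨ha, hb⟩ | ⟨ha, hb⟩
  · exact absurd (hmono' l p r ha hb) (not_le.2 k₁)
  · exact absurd (hmono' r p l ha hb) (not_le.2 k₂)

/-! ### Baire category, steep spikes in every interval, and the conclusion -/

theorem not_isSigmaMonotoneSpace_of_isNowhereDense {X : Type*} [MetricSpace X] [BaireSpace X]
    [Nonempty X] (h : ∀ M : Set X, IsMonotoneSpace M → IsNowhereDense M) :
    ¬ IsSigmaMonotoneSpace X := by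
  rintro ⟨M, hM, hU⟩
  obtain ⟨n, hn⟩ := nonempty_interior_of_iUnion_of_closed (f := fun n => closure (M n))
    (fun n => isClosed_closure)
    (univ_subset_iff.1 (hU ▸ iUnion_mono fun n => subset_closure))
  exact hn.ne_empty (h (M n) (hM n))

theorem EnumeratesUnitRationals.exists_gt_mem_Ioo {q : ℕ → ℝ} (hq : EnumeratesUnitRationals q)
    {u v : ℝ} (hu : 0 ≤ u) (hv : v ≤ 1) (huv : u < v) (N : ℕ) : ∃ n > N, q n ∈ Ioo u v := by
  have hfin : (q '' Iic N).Finite := (finite_Iic N).image q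
  obtain ⟨r, hr, hrN⟩ := (Rat.denseRange_cast (𝕜 := ℝ)).exists_mem_open
    (isOpen_Ioo.sdiff hfin.isClosed) ((Ioo_infinite huv).sdiff hfin).nonempty
  obtain ⟨n, hn⟩ : (r : ℝ) ∈ range q := by
    rw [hq.2]
    exact ⟨⟨hu.trans hr.1.le, hr.2.le.trans hv⟩, r, rfl⟩
  refine ⟨n, lt_of_not_ge fun hnN => hrN ⟨n, hnN, hn⟩, hn ▸ hr⟩

theorem RapidSpikes.exists_steep_spike {q a b : ℕ → ℝ} (h : RapidSpikes q a b)
    (hq : EnumeratesUnitRationals q) (u v c : ℝ) (hu : 0 ≤ u) (hv : v ≤ 1) (huv : u < v)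
    (hc : 0 < c) : ∃ x y z : ℝ, u < x ∧ x < y ∧ y < z ∧ z < v ∧
      c * graphDist (spikeSeries q a b) x z < graphDist (spikeSeries q a b) x y ∧
        c * graphDist (spikeSeries q a b) z x < graphDist (spikeSeries q a b) z y := by
  obtain ⟨N, hN⟩ := (h.tendsto_b.eventually_lt_const
    (show 0 < (v - u) / 3 by linarith)).exists_forall_of_atTop
  obtain ⟨K, hK⟩ := exists_nat_gt (3 * c)
  -- A centre in the middle third and a half-width below `(v - u) / 3` keep the whole spike inside
  -- `(u, v)`.
  obtain ⟨n, hn, hqn⟩ := hq.exists_gt_mem_Ioo (u := u + (v - u) / 3) (v := v - (v - u) / 3)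
    (by linarith) (by linarith) (by linarith) (max N K)
  have hbn := hN n ((le_max_left _ _).trans hn.le)
  have hcn : 3 * c < n := hK.trans_le (by exact_mod_cast (le_max_right N K).trans hn.le)
  have hb := h.b_pos n
  have hL := h.slopeSum_nonneg n
  have hsteep := h.steep n
  have hnext := h.a_succ_le n
  set f := spikeSeries q a b with hf
  set g := partialSpikes q a b n with hg
  set L := slopeSum a b n with hLdef
  have hsucc : ∀ x, partialSpikes q a b (n + 1) x = g x + a n * tent ((x - q n) / b n) :=
    fun x => Finset.sum_range_succ _ _
  have htop : g (q n) + a n ≤ f (q n) := by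
    have := h.partialSpikes_le (n + 1) (q n)
    rw [hsucc, sub_self, zero_div, tent_eq] at this
    simpa using this
  have hside : ∀ x, |x - q n| = b n →
      0 ≤ f x - g x ∧ f x - g x ≤ b n ∧ |g x - g (q n)| ≤ L * b n := by
    intro x hx
    have h1 := h.spikeSeries_le (n + 1) x
    have h2 := h.partialSpikes_le n x
    have h3 := h.abs_partialSpikes_sub_le n x (q n)
    rw [hsucc, mul_tent_eq hb, hx, sub_self, max_self, mul_zero, add_zero] at h1
    rw [hx] at h3
    exact ⟨by linarith, by linarith, h3⟩
  -- The tip gains `a n ≥ (n + 1) * ((1 + L) * b n)`. The earlier spikes cost at most `L * b n` and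
  -- the later ones at most `b n`, so one of the `n + 1` copies is lost.
  have hlow : ∀ x, |x - q n| = b n → n * ((1 + L) * b n) ≤ graphDist f x (q n) := by
    intro x hx
    obtain ⟨-, h1, h2⟩ := hside x hx
    rw [abs_le] at h2
    refine le_trans ?_ (abs_apply_sub_le_graphDist f x (q n))
    rw [abs_sub_comm]
    refine le_trans ?_ (le_abs_self _)
    linarith
  have hl : |q n - b n - q n| = b n := by
    rw [sub_sub_cancel_left, abs_neg, abs_of_pos hb]
  have hr : |q n + b n - q n| = b n := by
    rw [add_sub_cancel_left, abs_of_pos hb]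
  -- Horizontally `2 * b n`, vertically `2 * (L * b n)` from earlier spikes and `b n` from later
  -- ones; the `n`-th spike vanishes at both feet.
  have hupp : graphDist f (q n - b n) (q n + b n) ≤ 3 * ((1 + L) * b n) := by
    obtain ⟨l1, l2, l3⟩ := hside _ hl
    obtain ⟨r1, r2, r3⟩ := hside _ hr
    rw [abs_le] at l3 r3
    have h1 : |q n - b n - (q n + b n)| ≤ 2 * b n := by
      rw [abs_le]
      constructor <;> linarith
    have h2 : |f (q n - b n) - f (q n + b n)| ≤ 2 * (L * b n) + b n := by
      rw [abs_le]
      constructor <;> linarith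
    have h3 := graphDist_le f (q n - b n) (q n + b n)
    have h4 := mul_nonneg hL hb.le
    linarith
  have hkey : c * graphDist f (q n - b n) (q n + b n) < n * ((1 + L) * b n) := by
    have hpos : 0 < (1 + L) * b n := by positivity
    calc _ ≤ c * (3 * ((1 + L) * b n)) := mul_le_mul_of_nonneg_left hupp hc.le
      _ = 3 * c * ((1 + L) * b n) := by ring
      _ < _ := mul_lt_mul_of_pos_right hcn hpos
  refine ⟨q n - b n, q n, q n + b n, by linarith [hqn.1], by linarith, by linarith,
    by linarith [hqn.2], hkey.trans_le (hlow _ hl), ?_⟩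
  rw [graphDist_comm]
  exact hkey.trans_le (hlow _ hr)

theorem isCompact_unitGraph {f : ℝ → ℝ} (hf : Continuous f) : IsCompact (unitGraph f) :=
  isCompact_Icc.image (continuous_graphPoint hf)

theorem mainTheorem9 (q : ℕ → ℝ) (hq : EnumeratesUnitRationals q) :
    ∃ (a b : ℕ → ℝ) (f : ℝ → ℝ),
      (∀ n, 0 < a n) ∧ (∀ n, 0 < b n) ∧ Summable a ∧
      (∀ x ∈ Set.Icc (0 : ℝ) 1, HasSum (fun n => a n * tent ((x - q n) / b n)) (f x)) ∧
      AbsolutelyContinuousOnInterval f 0 1 ∧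
      IsStronglyPorous (unitGraph f) ∧
      (∀ M : Set (unitGraph f), IsMonotoneSpace M → IsNowhereDense M) ∧
      ¬ IsSigmaMonotoneSpace (unitGraph f) := by
  obtain ⟨a, b, h⟩ := exists_rapidSpikes q
  have hM := isNowhereDense_of_isMonotoneSpace h.continuous_spikeSeries (h.exists_steep_spike hq)
  have : CompactSpace (unitGraph (spikeSeries q a b)) :=
    isCompact_iff_compactSpace.1 (isCompact_unitGraph h.continuous_spikeSeries)
  have : Nonempty (unitGraph (spikeSeries q a b)) :=
    ⟨⟨_, 0, left_mem_Icc.2 zero_le_one, rfl⟩⟩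
  exact ⟨a, b, spikeSeries q a b, h.a_pos, h.b_pos, h.summable_a,
    fun x _ => h.hasSum_spikeSeries x, h.absolutelyContinuousOnInterval 0 1, h.isStronglyPorous,
    hM, not_isSigmaMonotoneSpace_of_isNowhereDense hM⟩
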